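/- **Theorem (the smallest Fisher-adjusted monotone metric).** For $n\ge 1$ let $\mathcal M_n$ be the manifold of positive definite complex $n\times n$ matrices of trace $1$; its tangent space at each point is the real vector space $T_n$ of traceless selfadjoint $n\times n$ matrices. A *metric* $g$ is a family consisting of one (smooth) Riemannian metric $D\mapsto g_D(\cdot,\cdot)$ on $\mathcal M_n$ for each $n$. It is *monotone* if $g_{T(D)}(T(A),T(A))\le g_D(A,A)$ for all $n,m$, every completely positive trace preserving linear map $T$ from $n\times n$ to $m\times m$ matrices, every $D\in\mathcal M_n$ with $T(D)\in\mathcal M_m$ and every $A\in T_n$. It is *Fisher-adjusted* if for every $n$ it restricts to the Fisher metric on diagonal matrices: $g_D(A,B)=\sum_i a_ib_i/p_i$ whenever $D=\mathrm{Diag}(p_1,\dots,p_n)\in\mathcal M_n$ and $A,B\in T_n$ are diagonal with diagonal entries $a_i$, $b_i$. For every $n$, $D\in\mathcal M_n$ and $B\in T_n$ the equation $DG+GD=2B$ has a unique solution $G$ among the complex $n\times n$ matrices, and $$g^{\mathrm{SL}}_D(A,B)=\mathrm{Tr}\,AG,\qquad\text{where } DG+GD=2B,$$ is real and defines a metric (the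 symmetric logarithmic derivative metric) which is monotone and Fisher-adjusted. It is the smallest such metric: for every Fisher-adjusted monotone metric $g$, $$g^{\mathrm{SL}}_D(A,A)\le g_D(A,A)\qquad\text{for all } n,\ D\in\mathcal M_n,\ A\in T_n .$$ Moreover $g^{\mathrm{SL}}$ corresponds to the arithmetic mean $f(t)=(1+t)/2$. Here a metric $g$ is said to correspond to a function $f$ if $f$ is operator monotone on $[0,\infty)$ (that is, $0\le K\le H$ implies $0\le f(K)\le f(H)$ for complex matrices of any order), $f(t)>0$ and $f(t)=t f(t^{-1})$ for $t>0$, and $$g_D(A,A)=\sum_{j,k=1}^n \frac{1}{p_k\,f(p_j/p_k)}\,|A_{jk}|^2$$ for all $n$, all $D=\mathrm{Diag}(p_1,\dots,p_n)\in\mathcal M_n$ and all $A\in T_n$; and $(1+t)/2$ is, on $(0,\infty)$, the only function to which $g^{\mathrm{SL}}$ corresponds. -/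

import Mathlib

namespace QuantumFisher

section

open scoped ComplexOrder ContDiff

/-- The manifold of invertible density matrices of size `n`: positive definite complex
matrices of trace one. -/
def stateSpace (n : ℕ) : Set (Matrix (Fin n) (Fin n) ℂ) :=
  {D | D.PosDef ∧ D.trace = 1}

/-- The tangent space of `stateSpace n` (at every point): the real vector space of traceless
selfadjoint matrices. -/
def tangentSpace (n : ℕ) : Submodule ℝ (Matrix (Fin n) (Fin n) ℂ) where
  carrier := {A | A.IsHermitian ∧ A.trace = 0}
  add_mem' := by
    rintro A B ⟨hA, hA'⟩ ⟨hB, hB'⟩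
    exact ⟨hA.add hB, by rw [Matrix.trace_add, hA', hB', add_zero]⟩
  zero_mem' := ⟨Matrix.isHermitian_zero, Matrix.trace_zero _ _⟩
  smul_mem' := by
    rintro c A ⟨hA, hA'⟩
    refine ⟨?_, by rw [Matrix.trace_smul, hA', smul_zero]⟩
    change (c • A).conjTranspose = c • A
    rw [Matrix.conjTranspose_smul, hA.eq, star_trivial]

/-- A linear map between matrix algebras is stochastic if it is completely positive and
preserves the trace. Complete positivity is: `∑ i, ∑ j, aᵢ* T(bᵢ* bⱼ) aⱼ ≥ 0`
for all finite families `a`, `b`. -/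
structure IsStochastic {n m : ℕ}
    (T : Matrix (Fin n) (Fin n) ℂ →ₗ[ℂ] Matrix (Fin m) (Fin m) ℂ) : Prop where
  completelyPositive : ∀ (k : ℕ) (a : Fin k → Matrix (Fin m) (Fin m) ℂ)
    (b : Fin k → Matrix (Fin n) (Fin n) ℂ),
    (∑ i, ∑ j, (a i).conjTranspose * T ((b i).conjTranspose * b j) * a j).PosSemidef
  trace_map : ∀ X, (T X).trace = X.trace

theorem IsStochastic.map_hermitian {n m : ℕ}
    {T : Matrix (Fin n) (Fin n) ℂ →ₗ[ℂ] Matrix (Fin m) (Fin m) ℂ} (hT : IsStochastic T)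
    {A : Matrix (Fin n) (Fin n) ℂ} (hA : A.IsHermitian) : (T A).IsHermitian := by
  have key : ∀ b : Matrix (Fin n) (Fin n) ℂ, (T (b.conjTranspose * b)).IsHermitian := by
    intro b
    have h := hT.completelyPositive 1 (fun _ => 1) (fun _ => b)
    simpa using h.isHermitian
  have h1 := key (A + 1)
  have h2 := key (A - 1)
  have e : A = (1 / 4 : ℝ) • ((A + 1).conjTranspose * (A + 1)
      - (A - 1).conjTranspose * (A - 1)) := by
    rw [Matrix.conjTranspose_add, Matrix.conjTranspose_sub, hA.eq, Matrix.conjTranspose_one]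
    have : (A + 1) * (A + 1) - (A - 1) * (A - 1) = (4 : ℝ) • A := by
      have h4 : (4 : ℝ) • A = A + A + A + A := by module
      rw [h4]; noncomm_ring
    rw [this, smul_smul]; norm_num
  have e2 : T A = (1 / 4 : ℝ) • (T ((A + 1).conjTranspose * (A + 1))
      - T ((A - 1).conjTranspose * (A - 1))) := by
    conv_lhs => rw [e]
    rw [LinearMap.map_smul_of_tower, map_sub]
  rw [e2]
  change Matrix.conjTranspose _ = _
  rw [Matrix.conjTranspose_smul, star_trivial, (h1.sub h2).eq]

/-- The differential of a stochastic map, acting on tangent vectors: `A ↦ T(A)`. -/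
def IsStochastic.tangentMap {n m : ℕ}
    {T : Matrix (Fin n) (Fin n) ℂ →ₗ[ℂ] Matrix (Fin m) (Fin m) ℂ} (hT : IsStochastic T)
    (A : tangentSpace n) : tangentSpace m :=
  ⟨T A, hT.map_hermitian A.2.1, by rw [hT.trace_map, A.2.2]⟩

section
/- The entrywise sup norm; it only serves to express smoothness in finite dimension. -/
attribute [local instance] Matrix.normedAddCommGroup Matrix.normedSpace

/-- A Riemannian metric on each of the manifolds `stateSpace n`, `n = 0, 1, 2, …`. The value
`toFun n D` matters only for `D ∈ stateSpace n`. Smoothness is expressed in the affine chart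
`X ↦ D + X`, with `X` in the tangent space, around every point `D`. -/
structure MetricFamily where
  toFun : ∀ n : ℕ, Matrix (Fin n) (Fin n) ℂ → LinearMap.BilinForm ℝ (tangentSpace n)
  symm : ∀ n, ∀ D ∈ stateSpace n, ∀ A B, toFun n D A B = toFun n D B A
  pos : ∀ n, ∀ D ∈ stateSpace n, ∀ A, A ≠ 0 → 0 < toFun n D A A
  smooth : ∀ n, ∀ D ∈ stateSpace n, ∀ A B,
    ContDiffAt ℝ ∞ (fun X : tangentSpace n => toFun n (D + (X : Matrix (Fin n) (Fin n) ℂ)) A B) 0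

end

/-- The differential of every stochastic map is a contraction, wherever it is defined. -/
def MetricFamily.IsMonotone (g : MetricFamily) : Prop :=
  ∀ (n m : ℕ) (T : Matrix (Fin n) (Fin n) ℂ →ₗ[ℂ] Matrix (Fin m) (Fin m) ℂ)
    (hT : IsStochastic T), ∀ D ∈ stateSpace n, T D ∈ stateSpace m →
    ∀ A : tangentSpace n,
      g.toFun m (T D) (hT.tangentMap A) (hT.tangentMap A) ≤ g.toFun n D A A

/-- On the submanifold of diagonal density matrices (probability distributions) the metric is
the Fisher metric `∑ i, aᵢ bᵢ / pᵢ`. -/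
def MetricFamily.IsFisherAdjusted (g : MetricFamily) : Prop :=
  ∀ (n : ℕ) (p : Fin n → ℝ), (∀ i, 0 < p i) → ∑ i, p i = 1 →
    ∀ A B : tangentSpace n, A.1.IsDiag → B.1.IsDiag →
      g.toFun n (Matrix.diagonal fun i => (p i : ℂ)) A B
        = ∑ i, (A.1 i i).re * (B.1 i i).re / p i

/-- `f`, as a function on `[0, ∞)`, is operator monotone: `0 ≤ K ≤ H` implies
`0 ≤ f(K) ≤ f(H)` for complex matrices of any order. -/
def IsOperatorMonotone (f : ℝ → ℝ) : Prop :=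
  ∀ (n : ℕ) (K H : Matrix (Fin n) (Fin n) ℂ), K.PosSemidef → (H - K).PosSemidef →
    (cfc f K).PosSemidef ∧ (cfc f H - cfc f K).PosSemidef

/-- The metric `g` corresponds to the function `f`: `f` is operator monotone, positive on
`(0, ∞)`, satisfies `f(t) = t f(1/t)`, and at `D = Diag(p₁, …, pₙ)` the squared length of `A` is
`∑ j k, c(pⱼ, pₖ) |Aⱼₖ|²` with `c(x, y) = 1 / (y f(x/y))`. -/
structure MetricFamily.CorrespondsTo (g : MetricFamily) (f : ℝ → ℝ) : Prop where
  operatorMonotone : IsOperatorMonotone f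
  pos : ∀ t, 0 < t → 0 < f t
  symm : ∀ t, 0 < t → f t = t * f t⁻¹
  formula : ∀ (n : ℕ) (p : Fin n → ℝ), (∀ i, 0 < p i) → ∑ i, p i = 1 →
    ∀ A : tangentSpace n,
      g.toFun n (Matrix.diagonal fun i => (p i : ℂ)) A A
        = ∑ j, ∑ k, 1 / (p k * f (p j / p k)) * ‖A.1 j k‖ ^ 2

end

end QuantumFisher
open QuantumFisher

namespace QuantumFisher

open scoped ComplexOrder ContDiff Matrix

/-! ### The equation `D * G + G * D = 2B` -/

section SylvesterEquation

variable {n : ℕ} {D : Matrix (Fin n) (Fin n) ℂ}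

/-! For positive definite `D` the map `X ↦ D * X + X * D` is injective, because `Tr Xᴴ(DX + XD) = Tr
XᴴDX + Tr XDXᴴ` is a sum of two nonnegative terms; by finite dimension it is invertible. Its inverse
depends smoothly on `D`, which gives the metric `sldMetric`, with squared length `Tr AG = Tr GDG`.

Monotonicity is a completed square: complete positivity of `T` bounds the cross terms `Tr H T(DK)`
and `Tr T(KD) H` between the solutions `K` at `D` and `H` at `T D`.

Minimality (`sldMetric_le`) holds because one measurement loses nothing. Pinching in an eigenbasis
of `G` is stochastic and makes both `D` and `A` diagonal, and the Fisher length of the result is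
exactly the original length `Tr AG`. Any Fisher-adjusted metric has that value after pinching, and a
monotone one had at least as much before.

The function `f` is recovered from the length of `σₓ` at qubit states whose eigenvalues have ratio
`t`. -/

theorem exists_conjTranspose_mul_self_of_posSemidef (hD : D.PosSemidef) :
    ∃ S : Matrix (Fin n) (Fin n) ℂ, D = Sᴴ * S := by
  open scoped MatrixOrder in
  obtain ⟨S, hS⟩ := CStarAlgebra.nonneg_iff_eq_star_mul_self.mp hD.nonneg
  exact ⟨S, hS⟩

/-- Writing `D = SᴴS` turns the trace into the squared Hilbert–Schmidt norm of `S * X`. -/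
theorem eq_zero_of_trace_conjTranspose_mul_mul_eq_zero (hD : D.PosDef)
    {X : Matrix (Fin n) (Fin n) ℂ} (h : (Xᴴ * D * X).trace = 0) : X = 0 := by
  obtain ⟨S, hS⟩ := exists_conjTranspose_mul_self_of_posSemidef hD.posSemidef
  have h1 : ((S * X)ᴴ * (S * X)).trace = 0 := by
    rw [← h, hS, Matrix.conjTranspose_mul]
    simp only [Matrix.mul_assoc]
  have h2 : S * X = 0 := Matrix.trace_conjTranspose_mul_self_eq_zero_iff.mp h1
  have h3 : D * X = 0 := by rw [hS, Matrix.mul_assoc, h2, Matrix.mul_zero]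
  exact (hD.isUnit.mul_right_eq_zero).mp h3

theorem eq_zero_of_anticommute (hD : D.PosDef) {X : Matrix (Fin n) (Fin n) ℂ}
    (h : D * X + X * D = 0) : X = 0 := by
  have h1 : 0 ≤ (Xᴴ * D * X).trace := (hD.posSemidef.conjTranspose_mul_mul_same X).trace_nonneg
  have h2 : 0 ≤ (X * D * Xᴴ).trace := (hD.posSemidef.mul_mul_conjTranspose_same X).trace_nonneg
  have h3 : (Xᴴ * D * X).trace + (X * D * Xᴴ).trace = 0 := by
    rw [Matrix.trace_mul_comm (X * D) Xᴴ, Matrix.mul_assoc, ← Matrix.trace_add, ← Matrix.mul_add, h,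
      Matrix.mul_zero, Matrix.trace_zero]
  exact eq_zero_of_trace_conjTranspose_mul_mul_eq_zero hD
    ((add_eq_zero_iff_of_nonneg h1 h2).mp h3).1

theorem sylvester_unique (hD : D.PosDef) {X Y : Matrix (Fin n) (Fin n) ℂ}
    (h : D * X + X * D = D * Y + Y * D) : X = Y := by
  refine sub_eq_zero.mp (eq_zero_of_anticommute hD ?_)
  rw [Matrix.mul_sub, Matrix.sub_mul, ← sub_eq_zero.mpr h]
  abel

/-- The adjoint `Gᴴ` solves the same equation, so uniqueness applies. -/
theorem isHermitian_of_sylvester (hD : D.PosDef) {B G : Matrix (Fin n) (Fin n) ℂ}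
    (hB : B.IsHermitian) (h : D * G + G * D = (2 : ℂ) • B) : G.IsHermitian := by
  refine sylvester_unique hD ?_
  have h' := congrArg Matrix.conjTranspose h
  simp only [Matrix.conjTranspose_add, Matrix.conjTranspose_mul, Matrix.conjTranspose_smul, hB.eq,
    hD.isHermitian.eq] at h'
  rw [add_comm, h', h]
  simp

/-- This makes the squared length visibly nonnegative when `G` is Hermitian. -/
theorem trace_mul_eq_of_sylvester {A G : Matrix (Fin n) (Fin n) ℂ}
    (h : D * G + G * D = (2 : ℂ) • A) : (A * G).trace = (G * D * G).trace := by
  have h1 : (2 : ℂ) * (A * G).trace = 2 * (G * D * G).trace := by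
    have h2 : (2 : ℂ) * (A * G).trace = (((2 : ℂ) • A) * G).trace := by simp
    rw [h2, ← h, Matrix.add_mul, Matrix.trace_add, Matrix.trace_mul_cycle D G G, two_mul]
  exact mul_left_cancel₀ two_ne_zero h1

section Inverse

variable {V E : Type*} [NormedAddCommGroup V] [NormedSpace ℝ V] [FiniteDimensional ℝ V]
  [NormedAddCommGroup E] [NormedSpace ℝ E] [FiniteDimensional ℝ E]

/-- Inversion is smooth at the units of the Banach algebra `E →L[ℝ] E`; the algebra equivalence `e`
transports this to endomorphisms, and both inverses are `0` off the units. -/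
theorem contDiffAt_ringInverse_apply (L : V →ₗ[ℝ] Module.End ℝ E) {v : V} (hv : IsUnit (L v))
    (x : E) : ContDiffAt ℝ ∞ (fun w => Ring.inverse (L w) x) v := by
  have : CompleteSpace E := FiniteDimensional.complete ℝ E
  let e : Module.End ℝ E ≃ₐ[ℝ] (E →L[ℝ] E) := Module.End.toContinuousLinearMap E
  obtain ⟨u, hu⟩ := hv.map e
  have h1 : ContDiffAt ℝ ∞ (fun w => Ring.inverse (e (L w))) v := by
    refine ContDiffAt.comp v (g := Ring.inverse) (f := fun w => e (L w)) ?_ ?_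
    · rw [← hu]
      exact contDiffAt_ringInverse ℝ u
    · exact (e.toLinearMap ∘ₗ L).toContinuousLinearMap.contDiff.contDiffAt
  have h2 : ∀ w, Ring.inverse (L w) x = Ring.inverse (e (L w)) x := fun w => by
    by_cases hw : IsUnit (L w)
    · obtain ⟨y, hy⟩ := hw
      have hy' : e (L w) = (Units.map (e : Module.End ℝ E →* (E →L[ℝ] E)) y : E →L[ℝ] E) := by
        rw [← hy]; rfl
      rw [hy', ← hy, Ring.inverse_unit, Ring.inverse_unit]
      rfl
    · have hw' : ¬ IsUnit (e (L w)) := fun h => hw (by simpa using h.map e.symm)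
      rw [Ring.inverse_non_unit _ hw, Ring.inverse_non_unit _ hw']
      rfl
  simp only [h2]
  exact h1.clm_apply contDiffAt_const

end Inverse

/-- The operator `X ↦ D * X + X * D`, as a linear function of `D`. -/
noncomputable def sylvester (n : ℕ) :
    Matrix (Fin n) (Fin n) ℂ →ₗ[ℝ] Module.End ℝ (Matrix (Fin n) (Fin n) ℂ) :=
  LinearMap.mul ℝ _ + (LinearMap.mul ℝ _).flip

theorem isUnit_sylvester (hD : D.PosDef) : IsUnit (sylvester n D) :=
  LinearMap.isUnit_iff_ker_eq_bot _ |>.mpr <|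
    LinearMap.ker_eq_bot.mpr fun _ _ h => sylvester_unique hD h

/-- The inverse of the Sylvester operator, which gives the solution `G` of `D * G + G * D = B`. -/
noncomputable def sylvesterInv (D : Matrix (Fin n) (Fin n) ℂ) :
    Module.End ℝ (Matrix (Fin n) (Fin n) ℂ) :=
  Ring.inverse (sylvester n D)

theorem sylvester_sylvesterInv (hD : D.PosDef) (B : Matrix (Fin n) (Fin n) ℂ) :
    D * sylvesterInv D B + sylvesterInv D B * D = B :=
  LinearMap.congr_fun (Ring.mul_inverse_cancel _ (isUnit_sylvester hD)) B


end SylvesterEquation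

/-! ### The symmetric logarithmic derivative metric -/

/-- The bilinear form `Re Tr A G`, where `D * G + G * D = 2 B`. -/
noncomputable def sldForm (n : ℕ) (D : Matrix (Fin n) (Fin n) ℂ) :
    LinearMap.BilinForm ℝ (tangentSpace n) :=
  LinearMap.mk₂ ℝ
    -- The real part only serves to give a real form for every `D`: the trace is already real when
    -- `D` is positive definite.
    (fun A B => ((A : Matrix (Fin n) (Fin n) ℂ) * sylvesterInv D ((2 : ℂ) • B.1)).trace.re)
    (fun A A' B => by simp [Matrix.add_mul])
    (fun c A B => by simp)
    (fun A B B' => by simp [Matrix.mul_add])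
    (fun c A B => by
      rw [Submodule.coe_smul, smul_comm, map_smul]
      simp)

theorem sldForm_apply {n : ℕ} {D : Matrix (Fin n) (Fin n) ℂ} (hD : D.PosDef) (A B : tangentSpace n)
    {G : Matrix (Fin n) (Fin n) ℂ} (hG : D * G + G * D = (2 : ℂ) • B.1) :
    ((sldForm n D A B : ℝ) : ℂ) = (A.1 * G).trace := by
  have e : sylvesterInv D ((2 : ℂ) • B.1) = G :=
    sylvester_unique hD (by rw [sylvester_sylvesterInv hD, hG])
  have h : (starRingEnd ℂ) (A.1 * G).trace = (A.1 * G).trace := by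
    have := Matrix.trace_conjTranspose (A.1 * G)
    rw [Matrix.conjTranspose_mul, (isHermitian_of_sylvester hD B.2.1 hG).eq, A.2.1.eq,
      Matrix.trace_mul_comm G] at this
    exact this.symm
  change (((A.1 * sylvesterInv D ((2 : ℂ) • B.1)).trace.re : ℝ) : ℂ) = _
  rw [e]
  exact Complex.conj_eq_iff_re.mp h

theorem exists_sylvester {n : ℕ} {D : Matrix (Fin n) (Fin n) ℂ} (hD : D.PosDef)
    (B : Matrix (Fin n) (Fin n) ℂ) : ∃ G, D * G + G * D = (2 : ℂ) • B :=
  ⟨_, sylvester_sylvesterInv hD _⟩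

/-- The symmetric logarithmic derivative metric. -/
noncomputable def sldMetric : MetricFamily where
  toFun := sldForm
  symm n D hD A B := by
    obtain ⟨G, hG⟩ := exists_sylvester hD.1 B.1
    obtain ⟨H, hH⟩ := exists_sylvester hD.1 A.1
    apply Complex.ofReal_injective
    rw [sldForm_apply hD.1 A B hG, sldForm_apply hD.1 B A hH]
    -- Doubled, both sides become `Tr DHG + Tr HDG` up to cyclic permutation.
    refine mul_left_cancel₀ (two_ne_zero (α := ℂ)) ?_
    have h2 : ∀ X Y : Matrix (Fin n) (Fin n) ℂ,
        (2 : ℂ) * (X * Y).trace = (((2 : ℂ) • X) * Y).trace := fun X Y => by simp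
    rw [h2, h2, ← hG, ← hH, Matrix.add_mul, Matrix.add_mul, Matrix.trace_add, Matrix.trace_add,
      Matrix.trace_mul_cycle D H G, Matrix.trace_mul_cycle D G H, add_comm]
  pos n D hD A hA := by
    obtain ⟨G, hG⟩ := exists_sylvester hD.1 A.1
    have hGh := isHermitian_of_sylvester hD.1 A.2.1 hG
    have e := sldForm_apply hD.1 A A hG
    rw [trace_mul_eq_of_sylvester hG] at e
    have h0 := (hD.1.posSemidef.conjTranspose_mul_mul_same G).trace_nonneg
    rw [hGh.eq, ← e] at h0
    refine lt_of_le_of_ne (by exact_mod_cast h0) fun h => hA ?_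
    rw [← h, Complex.ofReal_zero] at e
    have hG0 : G = 0 := by
      refine eq_zero_of_trace_conjTranspose_mul_mul_eq_zero hD.1 ?_
      rw [hGh.eq, ← e]
    rw [hG0] at hG
    ext1
    simpa using hG.symm
  smooth n D hD A B := by
    let _ : NormedAddCommGroup (Matrix (Fin n) (Fin n) ℂ) := Matrix.normedAddCommGroup
    let _ : NormedSpace ℝ (Matrix (Fin n) (Fin n) ℂ) := Matrix.normedSpace
    have h1 : ContDiffAt ℝ ∞
        (fun X : tangentSpace n => sylvesterInv (D + X.1) ((2 : ℂ) • B.1)) 0 := by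
      refine ContDiffAt.comp (0 : tangentSpace n)
        (g := fun D' => sylvesterInv D' ((2 : ℂ) • B.1)) ?_ ?_
      · simpa [sylvesterInv] using
          contDiffAt_ringInverse_apply (sylvester n) (isUnit_sylvester hD.1) ((2 : ℂ) • B.1)
      · exact contDiffAt_const.add (tangentSpace n).subtypeL.contDiff.contDiffAt
    let L : Matrix (Fin n) (Fin n) ℂ →ₗ[ℝ] ℝ :=
      Complex.reLm ∘ₗ Matrix.traceLinearMap (Fin n) ℝ ℂ ∘ₗ LinearMap.mulLeft ℝ A.1
    exact (L.toContinuousLinearMap.contDiff.contDiffAt).comp (0 : tangentSpace n) h1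

theorem sldMetric_apply {n : ℕ} {D : Matrix (Fin n) (Fin n) ℂ} (hD : D.PosDef)
    (A B : tangentSpace n) {G : Matrix (Fin n) (Fin n) ℂ}
    (hG : D * G + G * D = (2 : ℂ) • B.1) :
    ((sldMetric.toFun n D A B : ℝ) : ℂ) = (A.1 * G).trace :=
  sldForm_apply hD A B hG

/-! ### Monotonicity -/

theorem sldMetric_isMonotone : sldMetric.IsMonotone := by
  intro n m T hT D hD hTD A
  obtain ⟨K, hK⟩ := exists_sylvester hD.1 A.1
  obtain ⟨H, hH⟩ := exists_sylvester hTD.1 (T A.1)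
  have hKh := isHermitian_of_sylvester hD.1 A.2.1 hK
  have hHh := isHermitian_of_sylvester hTD.1 (hT.map_hermitian A.2.1) hH
  have e1 := sldMetric_apply hD.1 A A hK
  have e2 := sldMetric_apply hTD.1 (hT.tangentMap A) (hT.tangentMap A) hH
  have e3 : ((sldMetric.toFun m (T D) (hT.tangentMap A) (hT.tangentMap A) : ℝ) : ℂ)
      = (H * T D * H).trace := by rw [e2, ← trace_mul_eq_of_sylvester hH]; rfl
  change _ = (T A.1 * H).trace at e2
  obtain ⟨S, hS⟩ := exists_conjTranspose_mul_self_of_posSemidef hD.1.posSemidef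
  -- With `D = SᴴS`, this choice gives the noncommutative square `H T(D) H - H T(DK) - T(KD) H +
  -- T(KDK) ≥ 0`. With `x` and `y` the squared lengths after and before `T`, its trace is `x - 2x +
  -- y`.
  have h := (hT.completelyPositive 2 ![H, 1] ![S, -(S * K)]).trace_nonneg
  have s1 : (-(S * K))ᴴ * S = -(K * D) := by
    rw [Matrix.conjTranspose_neg, Matrix.conjTranspose_mul, hKh.eq, hS, Matrix.neg_mul,
      Matrix.mul_assoc]
  have s2 : Sᴴ * -(S * K) = -(D * K) := by rw [hS, Matrix.mul_neg, Matrix.mul_assoc]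
  have s3 : (-(S * K))ᴴ * -(S * K) = K * D * K := by
    rw [Matrix.conjTranspose_neg, Matrix.conjTranspose_mul, hKh.eq, hS, neg_mul_neg]
    simp only [Matrix.mul_assoc]
  have s5 : (H * T (D * K)).trace + (T (K * D) * H).trace = 2 * (T A.1 * H).trace := by
    rw [Matrix.trace_mul_comm H, ← Matrix.trace_add, ← Matrix.add_mul, ← map_add, hK, map_smul,
      Matrix.smul_mul, Matrix.trace_smul, smul_eq_mul]
  have s6 : (T (K * D * K)).trace = (A.1 * K).trace := by
    rw [hT.trace_map, trace_mul_eq_of_sylvester hK]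
  simp only [Fin.sum_univ_two, Matrix.cons_val_zero, Matrix.cons_val_one, hHh.eq, ← hS, s1, s2, s3]
    at h
  simp only [Matrix.conjTranspose_one, Matrix.one_mul, Matrix.mul_one, map_neg, Matrix.mul_neg,
    Matrix.neg_mul, Matrix.trace_add, Matrix.trace_neg, s6] at h
  have h' : (0 : ℂ) ≤ (H * T D * H).trace
      - ((H * T (D * K)).trace + (T (K * D) * H).trace) + (A.1 * K).trace := by
    convert h using 1
    ring
  rw [s5, ← e1, ← e2, ← e3] at h'
  have h'' : 0 ≤ sldMetric.toFun m (T D) (hT.tangentMap A) (hT.tangentMap A)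
      - 2 * sldMetric.toFun m (T D) (hT.tangentMap A) (hT.tangentMap A)
      + sldMetric.toFun n D A A := by exact_mod_cast h'
  linarith

/-! ### Diagonal states and the Fisher metric -/

section Diagonal

variable {n : ℕ} {p : Fin n → ℝ}

theorem posDef_diagonal_ofReal (hp : ∀ i, 0 < p i) :
    (Matrix.diagonal fun i => (p i : ℂ)).PosDef :=
  Matrix.PosDef.diagonal fun i => by exact_mod_cast hp i

theorem sylvester_diagonal (hp : ∀ i, 0 < p i) (B : Matrix (Fin n) (Fin n) ℂ) :
    let D : Matrix (Fin n) (Fin n) ℂ := Matrix.diagonal fun i => (p i : ℂ)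
    let G : Matrix (Fin n) (Fin n) ℂ := Matrix.of fun j k => 2 * B j k / (p j + p k)
    D * G + G * D = (2 : ℂ) • B := by
  ext j k
  have h : ((p j : ℂ) + p k) ≠ 0 := by exact_mod_cast (add_pos (hp j) (hp k)).ne'
  simp only [Matrix.add_apply, Matrix.diagonal_mul, Matrix.mul_diagonal, Matrix.of_apply,
    Matrix.smul_apply, smul_eq_mul]
  field_simp

theorem sldMetric_diagonal (hp : ∀ i, 0 < p i) (A B : tangentSpace n) :
    ((sldMetric.toFun n (Matrix.diagonal fun i => (p i : ℂ)) A B : ℝ) : ℂ)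
      = ∑ j, ∑ k, A.1 j k * (2 * B.1 k j / (p k + p j)) := by
  rw [sldMetric_apply (posDef_diagonal_ofReal hp) A B (sylvester_diagonal hp B.1)]
  simp [Matrix.trace, Matrix.mul_apply]

theorem sldMetric_diagonal_self (hp : ∀ i, 0 < p i) (A : tangentSpace n) :
    sldMetric.toFun n (Matrix.diagonal fun i => (p i : ℂ)) A A
      = ∑ j, ∑ k, 1 / (p k * ((1 + p j / p k) / 2)) * ‖A.1 j k‖ ^ 2 := by
  apply Complex.ofReal_injective
  rw [sldMetric_diagonal hp]
  push_cast
  refine Finset.sum_congr rfl fun j _ => Finset.sum_congr rfl fun k _ => ?_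
  have hk : (p k : ℂ) ≠ 0 := by exact_mod_cast (hp k).ne'
  have h : ((p k : ℂ) + p j) ≠ 0 := by exact_mod_cast (add_pos (hp k) (hp j)).ne'
  rw [← Complex.mul_conj', ← A.2.1.apply k j]
  simp only [← starRingEnd_apply]
  field_simp

theorem coe_re_diag (A : tangentSpace n) (i : Fin n) : ((A.1 i i).re : ℂ) = A.1 i i :=
  Complex.conj_eq_iff_re.mp (A.2.1.apply i i)

end Diagonal

theorem sldMetric_isFisherAdjusted : sldMetric.IsFisherAdjusted := by
  intro n p hp _ A B hA hB
  apply Complex.ofReal_injective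
  rw [sldMetric_diagonal hp]
  push_cast
  refine Finset.sum_congr rfl fun j _ => ?_
  rw [Finset.sum_eq_single j (fun k _ hk => by rw [hA hk.symm, zero_mul]) (by simp),
    coe_re_diag, coe_re_diag]
  have hk : (p j : ℂ) ≠ 0 := by exact_mod_cast (hp j).ne'
  rw [← two_mul]
  field_simp

/-! ### Kraus maps and pinching -/

section Kraus

variable {n m k : ℕ}

/-- The map `X ↦ ∑ l, Vₗ* X Vₗ`. -/
def krausMap (V : Fin k → Matrix (Fin n) (Fin m) ℂ) :
    Matrix (Fin n) (Fin n) ℂ →ₗ[ℂ] Matrix (Fin m) (Fin m) ℂ where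
  toFun X := ∑ l, (V l)ᴴ * X * V l
  map_add' X Y := by simp [Matrix.mul_add, Matrix.add_mul, Finset.sum_add_distrib]
  map_smul' c X := by simp [Finset.smul_sum]

theorem krausMap_apply (V : Fin k → Matrix (Fin n) (Fin m) ℂ) (X : Matrix (Fin n) (Fin n) ℂ) :
    krausMap V X = ∑ l, (V l)ᴴ * X * V l := rfl

theorem isStochastic_krausMap (V : Fin k → Matrix (Fin n) (Fin m) ℂ)
    (hV : ∑ l, V l * (V l)ᴴ = 1) : IsStochastic (krausMap V) where
  completelyPositive r a b := by
    -- For each `l` the double sum factors as `YᴴY` with `Y = ∑ i, bᵢ Vₗ aᵢ`.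
    have e : ∑ i, ∑ j, (a i)ᴴ * krausMap V ((b i)ᴴ * b j) * a j
        = ∑ l, (∑ i, b i * V l * a i)ᴴ * (∑ j, b j * V l * a j) := by
      simp only [krausMap_apply, Matrix.conjTranspose_sum, Matrix.sum_mul, Matrix.mul_sum,
        Matrix.conjTranspose_mul, Matrix.mul_assoc]
      rw [Finset.sum_comm_cycle]
      exact Finset.sum_congr rfl fun _ _ => Finset.sum_comm
    rw [e]
    exact Matrix.posSemidef_sum _ fun l _ => Matrix.posSemidef_conjTranspose_mul_self _
  trace_map X := by
    rw [krausMap_apply, Matrix.trace_sum]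
    simp only [Matrix.trace_mul_cycle _ X]
    rw [← Matrix.trace_sum, ← Matrix.sum_mul, hV, Matrix.one_mul]

end Kraus

section Pinching

variable {n : ℕ}

/-- The Kraus operators of the measurement in the orthonormal basis of columns of `U`. -/
def pinchingKraus (U : Matrix (Fin n) (Fin n) ℂ) (l : Fin n) : Matrix (Fin n) (Fin n) ℂ :=
  U * Matrix.single l l 1

theorem krausMap_pinchingKraus (U X : Matrix (Fin n) (Fin n) ℂ) :
    krausMap (pinchingKraus U) X = Matrix.diagonal fun i => (Uᴴ * X * U) i i := by
  have h : ∀ l, (pinchingKraus U l)ᴴ * X * pinchingKraus U l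
      = Matrix.single l l ((Uᴴ * X * U) l l) := fun l => by
    have : (pinchingKraus U l)ᴴ * X * pinchingKraus U l
        = Matrix.single l l 1 * (Uᴴ * X * U) * Matrix.single l l 1 := by
      simp [pinchingKraus, Matrix.conjTranspose_mul, Matrix.mul_assoc]
    rw [this, Matrix.single_mul_mul_single]
    simp
  rw [krausMap_apply]
  simp only [h]
  exact Matrix.sum_single_eq_diagonal _

theorem isStochastic_pinching {U : Matrix (Fin n) (Fin n) ℂ} (hU : U * Uᴴ = 1) :
    IsStochastic (krausMap (pinchingKraus U)) := by
  refine isStochastic_krausMap _ ?_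
  have h : ∀ l, pinchingKraus U l * (pinchingKraus U l)ᴴ = U * Matrix.single l l 1 * Uᴴ := by
    intro l
    rw [pinchingKraus, Matrix.conjTranspose_mul, Matrix.conjTranspose_single, star_one,
      ← Matrix.mul_assoc, Matrix.mul_assoc U, Matrix.single_mul_single_same, one_mul]
  simp only [h]
  rw [← Matrix.sum_mul, ← Matrix.mul_sum, Matrix.sum_single_one, Matrix.mul_one, hU]

end Pinching

/-! ### Minimality -/

theorem sldMetric_le {g : MetricFamily} (hm : g.IsMonotone) (hF : g.IsFisherAdjusted) {n : ℕ}
    {D : Matrix (Fin n) (Fin n) ℂ} (hD : D ∈ stateSpace n) (A : tangentSpace n) :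
    sldMetric.toFun n D A A ≤ g.toFun n D A A := by
  obtain ⟨G, hG⟩ := exists_sylvester hD.1 A.1
  have hGh := isHermitian_of_sylvester hD.1 A.2.1 hG
  -- The optimal measurement is in an eigenbasis of `G`, not of `D` or `A`.
  obtain ⟨U, γ, hU, hU', hγ⟩ : ∃ (U : Matrix (Fin n) (Fin n) ℂ) (γ : Fin n → ℝ),
      U * Uᴴ = 1 ∧ Uᴴ * U = 1 ∧ G = U * Matrix.diagonal (fun i => (γ i : ℂ)) * Uᴴ :=
    ⟨hGh.eigenvectorUnitary, hGh.eigenvalues, Unitary.coe_mul_star_self _,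
      Unitary.coe_star_mul_self _, hGh.spectral_theorem⟩
  have hT := isStochastic_pinching hU
  set T := krausMap (pinchingKraus U) with hTdef
  have hUinj : Function.Injective U.mulVec := fun x y h => by
    have := congrArg (Uᴴ.mulVec) h
    simpa [Matrix.mulVec_mulVec, hU'] using this
  have hD' : (Uᴴ * D * U).PosDef := hD.1.conjTranspose_mul_mul_same hUinj
  set p : Fin n → ℝ := fun i => ((Uᴴ * D * U) i i).re with hpdef
  have hpc : ∀ i, ((p i : ℝ) : ℂ) = (Uᴴ * D * U) i i := fun i =>
    Complex.conj_eq_iff_re.mp (hD'.isHermitian.apply i i)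
  have hp : ∀ i, 0 < p i := fun i => by
    have := hD'.diag_pos (i := i)
    rw [← hpc] at this
    exact_mod_cast this
  have hTD : T D = Matrix.diagonal fun i => (p i : ℂ) := by
    rw [hTdef, krausMap_pinchingKraus]
    simp only [hpc]
  have hsum : ∑ i, p i = 1 := by
    have h := hT.trace_map D
    rw [hTD, hD.2, Matrix.trace_diagonal] at h
    exact_mod_cast h
  have hTDmem : T D ∈ stateSpace n :=
    ⟨hTD ▸ posDef_diagonal_ofReal hp, by rw [hT.trace_map, hD.2]⟩
  -- In this basis `G` is diagonal, so the diagonal entries of `DG + GD = 2A` read `2 γᵢ pᵢ = 2 aᵢ`.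
  -- Hence the Fisher length `∑ aᵢ² / pᵢ` equals `∑ aᵢ γᵢ = Tr AG`.
  have hA' : ∀ i, (Uᴴ * A.1 * U) i i = γ i * p i := fun i => by
    have h : (Uᴴ * D * U) * Matrix.diagonal (fun i => (γ i : ℂ))
        + Matrix.diagonal (fun i => (γ i : ℂ)) * (Uᴴ * D * U) = (2 : ℂ) • (Uᴴ * A.1 * U) := by
      have h1 : Uᴴ * (D * G + G * D) * U = (2 : ℂ) • (Uᴴ * A.1 * U) := by rw [hG]; simp
      rw [← h1, hγ]
      simp only [Matrix.mul_add, Matrix.add_mul, Matrix.mul_assoc, hU', Matrix.mul_one]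
      simp only [← Matrix.mul_assoc, hU', Matrix.one_mul]
    have h2 := congrFun (congrFun h i) i
    simp only [Matrix.add_apply, Matrix.mul_diagonal, Matrix.diagonal_mul, ← hpc,
      Matrix.smul_apply, smul_eq_mul] at h2
    linear_combination -(1 / 2 : ℂ) * h2
  have hTA : (hT.tangentMap A).1 = Matrix.diagonal fun i => (γ i * p i : ℂ) := by
    change T A.1 = _
    rw [hTdef, krausMap_pinchingKraus]
    simp only [hA']
  have hdiag : (hT.tangentMap A).1.IsDiag := hTA ▸ Matrix.isDiag_diagonal _
  have hfish := hF n p hp hsum _ _ hdiag hdiag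
  rw [hTA, ← hTD] at hfish
  have key : sldMetric.toFun n D A A
      = g.toFun n (T D) (hT.tangentMap A) (hT.tangentMap A) := by
    rw [hfish]
    apply Complex.ofReal_injective
    have htr : (A.1 * G).trace
        = ((Uᴴ * A.1 * U) * Matrix.diagonal (fun i => (γ i : ℂ))).trace := by
      rw [hγ, ← Matrix.mul_assoc, Matrix.trace_mul_comm]
      simp only [Matrix.mul_assoc]
    rw [sldMetric_apply hD.1 A A hG, htr, Matrix.trace]
    push_cast
    refine Finset.sum_congr rfl fun i _ => ?_
    have : (p i : ℂ) ≠ 0 := by exact_mod_cast (hp i).ne'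
    simp [Matrix.mul_diagonal, hA']
    field_simp
  rw [key]
  exact hm n n T hT D hD hTDmem A

/-! ### The corresponding function and its uniqueness -/

theorem isOperatorMonotone_one_add_div_two : IsOperatorMonotone fun t => (1 + t) / 2 := by
  have key : ∀ (n : ℕ) (K : Matrix (Fin n) (Fin n) ℂ), K.PosSemidef →
      cfc (fun t : ℝ => (1 + t) / 2) K = (1 / 2 : ℝ) • (1 + K) := by
    intro n K hK
    have hs : IsSelfAdjoint K := hK.isHermitian
    have e : (fun t : ℝ => (1 + t) / 2) = fun t => (1 / 2 : ℝ) • (1 + t) := by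
      ext t; simp; ring
    rw [e, cfc_smul (1 / 2 : ℝ) (fun t : ℝ => 1 + t) K, cfc_const_add (1 : ℝ) (fun t => t) K,
      cfc_id' ℝ K, map_one]
  intro n K H hK hKH
  have hH : H.PosSemidef := by simpa using hK.add hKH
  rw [key n K hK, key n H hH]
  refine ⟨(Matrix.PosSemidef.one.add hK).smul (by norm_num), ?_⟩
  rw [← smul_sub, add_sub_add_left_eq_sub]
  exact hKH.smul (by norm_num)

theorem sldMetric_correspondsTo : sldMetric.CorrespondsTo fun t => (1 + t) / 2 where
  operatorMonotone := isOperatorMonotone_one_add_div_two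
  pos t ht := by positivity
  symm t ht := by field_simp; ring
  formula n p hp _ A := sldMetric_diagonal_self hp A

/-- The tangent vector `σₓ` of the manifold of states of a qubit. -/
def offDiagonal : tangentSpace 2 :=
  ⟨!![0, 1; 1, 0], by
    ext i j; fin_cases i <;> fin_cases j <;> simp, by simp [Matrix.trace]⟩

/-- The state is the qubit with eigenvalue ratio `t`. Its two off-diagonal terms involve `f t` and
`f t⁻¹`, and the symmetry of `f` makes them equal, so the length determines `f t`. -/
theorem MetricFamily.CorrespondsTo.offDiagonal_eq {g : MetricFamily} {f : ℝ → ℝ}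
    (h : g.CorrespondsTo f) {t : ℝ} (ht : 0 < t) :
    g.toFun 2 (Matrix.diagonal fun i => ((![t / (1 + t), 1 / (1 + t)] i : ℝ) : ℂ))
      offDiagonal offDiagonal = 2 * (1 + t) / f t := by
  have h1 : 0 < 1 + t := by positivity
  have hf := h.pos t ht
  have hf' : f t⁻¹ = f t / t := by rw [h.symm t ht]; field_simp
  rw [h.formula 2 _ (fun i => by fin_cases i <;> simp <;> positivity)
    (by simp [Fin.sum_univ_two]; field_simp; ring)]
  have e1 : t / (1 + t) / (1 / (1 + t)) = t := by field_simp
  have e2 : 1 / (1 + t) / (t / (1 + t)) = t⁻¹ := by field_simp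
  simp only [Fin.sum_univ_two, offDiagonal, Matrix.cons_val_zero, Matrix.cons_val_one,
    Matrix.of_apply, Matrix.cons_val', e1, e2, hf']
  simp
  field_simp
  ring

theorem MetricFamily.CorrespondsTo.unique {g : MetricFamily} {f₁ f₂ : ℝ → ℝ}
    (h₁ : g.CorrespondsTo f₁) (h₂ : g.CorrespondsTo f₂) {t : ℝ} (ht : 0 < t) : f₁ t = f₂ t := by
  have h := (h₁.offDiagonal_eq ht).symm.trans (h₂.offDiagonal_eq ht)
  have := h₁.pos t ht
  have := h₂.pos t ht
  field_simp at h
  exact h.symm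

end QuantumFisher

theorem theorem3p3 :
    (∀ n : ℕ, ∀ D ∈ stateSpace n, ∀ B : tangentSpace n,
      ∃! G : Matrix (Fin n) (Fin n) ℂ, D * G + G * D = (2 : ℂ) • B.1) ∧
    ∃ gSL : MetricFamily,
      (∀ n : ℕ, ∀ D ∈ stateSpace n, ∀ A B : tangentSpace n,
        ∀ G : Matrix (Fin n) (Fin n) ℂ, D * G + G * D = (2 : ℂ) • B.1 →
          ((gSL.toFun n D A B : ℝ) : ℂ) = (A.1 * G).trace) ∧
      gSL.IsMonotone ∧ gSL.IsFisherAdjusted ∧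
      (∀ g : MetricFamily, g.IsMonotone → g.IsFisherAdjusted →
        ∀ n : ℕ, ∀ D ∈ stateSpace n, ∀ A : tangentSpace n,
          gSL.toFun n D A A ≤ g.toFun n D A A) ∧
      gSL.CorrespondsTo (fun t : ℝ => (1 + t) / 2) ∧
      (∀ f : ℝ → ℝ, gSL.CorrespondsTo f → ∀ t : ℝ, 0 < t → f t = (1 + t) / 2) := by
  refine ⟨fun n D hD B => ?_, sldMetric, fun n D hD A B G hG => sldMetric_apply hD.1 A B hG,
    sldMetric_isMonotone, sldMetric_isFisherAdjusted, fun g hm hF n D hD A => sldMetric_le hm hF hD A,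
    sldMetric_correspondsTo, fun f hf t ht => hf.unique sldMetric_correspondsTo ht⟩
  obtain ⟨G, hG⟩ := exists_sylvester hD.1 B.1
  exact ⟨G, hG, fun G' hG' => sylvester_unique hD.1 (hG'.trans hG.symm)⟩
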